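/- Let $m\ge 2$, let $\Omega=\{\mathcal I_1,\dots,\mathcal I_m\}$ be a set of $m$ items, let $\phi$ be a ranking of $\Omega$ (a bijection $\phi:\Omega\to\{1,\dots,m\}$), and let $\epsilon>0$. For $x,y:\Omega\to\mathbb R$ put $$T(x,y)=\sum_{\mathcal I_i,\mathcal I_j\in\Omega} I\big((x(\mathcal I_i)-x(\mathcal I_j))(y(\mathcal I_i)-y(\mathcal I_j))>0\big),$$ the number of concordant (ordered) pairs. Let $\mathcal A_\epsilon(\phi)$ be the random output $\widetilde\phi$ of the following algorithm. Initially, $\widetilde\phi(\phi^{-1}(1))=1$ and $\chi=\{\phi^{-1}(1)\}$. Then for $t=2,\dots,m$: let $\mathcal I=\phi^{-1}(t)$ and, for $k\in\{0,\dots,t-1\}$, $$\tau(k,\chi)=\sum_{\mathcal J\in\chi} I\big((t-\phi(\mathcal J))(k+0.5-\widetilde\phi(\mathcal J))>0\big);$$ sample $V\in\{0,\dots,t-1\}$ (given the current $\widetilde\phi$ and $\chi$) with $$\mathbb P(V=k)=\frac{\exp\big(\epsilon(m-1)^{-1}\tau(k,\chi)\big)}{\sum_{k'=0}^{t-1}\exp\big(\epsilon(m-1)^{-1}\tau(k',\chi)\big)};$$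 increase $\widetilde\phi(\mathcal J)$ by $1$ for all $\mathcal J\in\chi$ with $\widetilde\phi(\mathcal J)>V+0.5$, set $\widetilde\phi(\mathcal I)=V+1$, and add $\mathcal I$ to $\chi$. Let $\mathcal M^{lap}_{\lambda}(\phi)=(\phi(\mathcal I_i)+\xi_i)_{i=1}^m$, where $\xi_1,\dots,\xi_m$ are i.i.d. with the Laplace distribution of mean $0$ and scale $\lambda$. Then $$\mathbb E\big[T(\phi,\mathcal A_\epsilon(\phi))\big]>\mathbb E\big[T(\phi,\mathcal M^{lap}_{2(m-1)\epsilon^{-1}}(\phi))\big].$$ -/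

import Mathlib

open MeasureTheory

noncomputable section

/-- A ranking of the `m` items (indexed by `Fin m`): a bijection from the items onto the ranks
`{1, ..., m}`; `(φ i : ℕ)` is the rank of item `i`, and `φ.symm t` is the item of rank `t`. -/
abbrev Ranking (m : ℕ) : Type := Fin m ≃ Finset.Icc 1 m

/-- The ranks of a ranking, as a vector of real numbers. -/
def Ranking.toVec {m : ℕ} (φ : Ranking m) : Fin m → ℝ := fun i => ((φ i : ℕ) : ℝ)

/-- `T(x, y)`: the number of (ordered) pairs of items that `x` and `y` order in the same way.
It is defined for arbitrary real score vectors, because the output of the Laplace mechanism is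
a vector of real numbers. -/
def concordantPairs {m : ℕ} (x y : Fin m → ℝ) : ℝ :=
  ∑ i, ∑ j, if 0 < (x i - x j) * (y i - y j) then 1 else 0

/-! ### The privacy preserving ranking algorithm -/

/-- The variables of the algorithm: the current synthetic ranks (meaningful for the items that
have been processed) and the set `χ` of the items that have been processed. -/
structure AlgState (m : ℕ) where
  /-- the current synthetic ranks -/
  synth : Fin m → ℕ
  /-- the set of processed items -/
  processed : Finset (Fin m)

/-- `τ(k, χ)`: the number of processed items `l` for which placing the item of rank `t` between
the synthetic positions `k` and `k + 1` agrees with `φ`. -/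
def tau {m : ℕ} (φ : Ranking m) (t : ℕ) (s : AlgState m) (k : ℕ) : ℝ :=
  ∑ l ∈ s.processed,
    if 0 < ((t : ℝ) - ((φ l : ℕ) : ℝ)) * ((k : ℝ) + 1 / 2 - (s.synth l : ℝ)) then 1 else 0

/-- The unnormalized weight `exp(ε (m - 1)⁻¹ τ(k, χ))` of the value `k`. -/
def positionWeight {m : ℕ} (φ : Ranking m) (ε : ℝ) (t : ℕ) (s : AlgState m) (k : ℕ) : ℝ :=
  Real.exp (ε * ((m : ℝ) - 1)⁻¹ * tau φ t s k)

/-- The sampling probability of the value `k`, which is `0` outside `{0, ..., t - 1}`. -/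
def positionProb {m : ℕ} (φ : Ranking m) (ε : ℝ) (t : ℕ) (s : AlgState m) (k : ℕ) : ENNReal :=
  if k ∈ Finset.range t then
    ENNReal.ofReal
      (positionWeight φ ε t s k / ∑ k' ∈ Finset.range t, positionWeight φ ε t s k')
  else 0

theorem sum_positionProb {m : ℕ} (φ : Ranking m) (ε : ℝ) {t : ℕ} (ht : 1 ≤ t) (s : AlgState m) :
    ∑ k ∈ Finset.range t, positionProb φ ε t s k = 1 := by
  have hpos : 0 < ∑ k' ∈ Finset.range t, positionWeight φ ε t s k' :=
    Finset.sum_pos (fun _ _ => Real.exp_pos _) ⟨0, Finset.mem_range.2 ht⟩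
  have h1 : ∑ k ∈ Finset.range t, positionProb φ ε t s k =
      ∑ k ∈ Finset.range t, ENNReal.ofReal
        (positionWeight φ ε t s k / ∑ k' ∈ Finset.range t, positionWeight φ ε t s k') :=
    Finset.sum_congr rfl fun k hk => if_pos hk
  have h2 : ∀ k ∈ Finset.range t, 0 ≤
      positionWeight φ ε t s k / ∑ k' ∈ Finset.range t, positionWeight φ ε t s k' :=
    fun k _ => div_nonneg (Real.exp_pos _).le hpos.le
  rw [h1, ← ENNReal.ofReal_sum_of_nonneg h2, ← Finset.sum_div, div_self hpos.ne', ENNReal.ofReal_one]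

/-- The law of the value `V⁽ᵗ⁾ ∈ {0, ..., t - 1}` sampled in iteration `t`. -/
def positionPMF {m : ℕ} (φ : Ranking m) (ε : ℝ) {t : ℕ} (ht : 1 ≤ t) (s : AlgState m) : PMF ℕ :=
  PMF.ofFinset (positionProb φ ε t s) (Finset.range t) (sum_positionProb φ ε ht s)
    fun _ hk => if_neg hk

/-- The rearrangement after the value `v` has been sampled for the item `j`: the processed items
with synthetic rank larger than `v + 1 / 2` are shifted up by one, and `j` gets rank `v + 1`. -/
def insertItem {m : ℕ} (s : AlgState m) (j : Fin m) (v : ℕ) : AlgState m where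
  synth := fun i =>
    if i = j then v + 1
    else if i ∈ s.processed ∧ (v : ℝ) + 1 / 2 < (s.synth i : ℝ) then s.synth i + 1
    else s.synth i
  processed := insert j s.processed

/-- Iteration `t` of the algorithm, which inserts the item of rank `t`. -/
def iteration {m : ℕ} (φ : Ranking m) (ε : ℝ) (t : Finset.Icc 1 m) (s : AlgState m) :
    PMF (AlgState m) :=
  (positionPMF φ ε (Finset.mem_Icc.1 t.2).1 s).map fun v => insertItem s (φ.symm t) v

/-- The law of the variables of the algorithm after iteration `n + 1`. The initialization counts
as iteration `1`: it gives the item of rank `1` the synthetic rank `1`. -/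
def stateAfter {m : ℕ} (φ : Ranking m) (ε : ℝ) : (n : ℕ) → n + 1 ≤ m → PMF (AlgState m)
  | 0, h =>
    let i := φ.symm ⟨1, Finset.mem_Icc.2 ⟨le_rfl, h⟩⟩
    PMF.pure ⟨fun i' => if i' = i then 1 else 0, {i}⟩
  | n + 1, h =>
    (stateAfter φ ε n (Nat.le_of_succ_le h)).bind
      (iteration φ ε ⟨n + 2, Finset.mem_Icc.2 ⟨Nat.le_add_left 1 (n + 1), h⟩⟩)

/-- The law of the output of the algorithm on the input `φ`: the synthetic ranks after
iteration `m`. -/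
def rankingAlgorithm {m : ℕ} (hm : 1 ≤ m) (ε : ℝ) (φ : Ranking m) : PMF (Fin m → ℕ) :=
  (stateAfter φ ε (m - 1) (Nat.sub_add_cancel hm).le).map AlgState.synth

/-! ### The Laplace mechanism -/

/-- The Laplace distribution with mean `0` and scale `b`. -/
def laplaceMeasure (b : ℝ) : Measure ℝ :=
  volume.withDensity fun x => ENNReal.ofReal (1 / (2 * b) * Real.exp (-|x| / b))

/-- The law of the output `(φ(i) + ξ_i)_i` of the Laplace mechanism, where the `ξ_i` are
independent with the Laplace distribution of mean `0` and scale `b`. -/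
def laplaceMechanism {m : ℕ} (b : ℝ) (φ : Ranking m) : Measure (Fin m → ℝ) :=
  (Measure.pi fun _ : Fin m => laplaceMeasure b).map fun ξ i => φ.toVec i + ξ i

end

/-! Put c = ε/(m-1). When the item of rank t is inserted, every processed item has smaller rank, so
τ(k) = k and V has weights exp(ck) on {0, …, t-1}. The new item is concordant with exactly V
processed items, and earlier pairs keep their relative order. The algorithm's expectation is
therefore twice the sum of the truncated geometric means over t = 2, …, m.

The Laplace scale is 1/a with a = c/2, and a pair at rank distance d > 0 stays concordant with
probability p(d) = 1 - e^{-ad}(1 + ad/2)/2. Grouping pairs by their larger rank t gives twice the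
sum over t of p(1) + … + p(t-1). It suffices to compare the two sums for each t.

That comparison telescopes: p(d) is less than the gain in the truncated mean when the number of
values grows from d to d + 1 (`truncGeomMean_step`). Replacing a by the smaller 1 - e^{-a} in the
linear factor of p only enlarges p and leaves an algebraic inequality in r = e^{-c/4}, v = r^d and
d. Since d enters linearly, an AM-GM bound on d eliminates it, and a polynomial inequality in r and
v remains. -/

/-! ### Truncated geometric means: the increment inequality -/

/-- Substituting v = 1/(1+p) and r = 1/(1+q) maps the open unit square to p, q > 0. After
denominators are cleared, the expansion in p and q has no negative coefficient. -/
theorem step_polynomial_pos {r v : ℝ} (hv : 0 < v) (hv1 : v < 1) (hr : 0 < r) (hr1 : r < 1) :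
    0 < 2 * (1 + v ^ 2) * (1 - v ^ 4 * r ^ 4) * v + 4 * v ^ 3 * r ^ 4 * (1 + v ^ 2)
      - 4 * v ^ 2 * r * (1 + r ^ 2) + r * (1 - v ^ 4) * (1 - v ^ 4 * r ^ 4) := by
  obtain ⟨p, hp, rfl⟩ : ∃ p : ℝ, 0 < p ∧ v = (1 + p)⁻¹ :=
    ⟨v⁻¹ - 1, by linarith [(one_lt_inv₀ hv).2 hv1], by simp⟩
  obtain ⟨q, hq, rfl⟩ : ∃ q : ℝ, 0 < q ∧ r = (1 + q)⁻¹ :=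
    ⟨r⁻¹ - 1, by linarith [(one_lt_inv₀ hr).2 hr1], by simp⟩
  have h : 0 < (1 + p) ^ 8 * (1 + q) ^ 5 := by positivity
  refine pos_of_mul_pos_right (b := _) ?_ h.le
  have e : (1 + p) ^ 8 * (1 + q) ^ 5 *
      (2 * (1 + (1 + p)⁻¹ ^ 2) * (1 - (1 + p)⁻¹ ^ 4 * (1 + q)⁻¹ ^ 4) * (1 + p)⁻¹
        + 4 * (1 + p)⁻¹ ^ 3 * (1 + q)⁻¹ ^ 4 * (1 + (1 + p)⁻¹ ^ 2)
        - 4 * (1 + p)⁻¹ ^ 2 * (1 + q)⁻¹ * (1 + (1 + q)⁻¹ ^ 2)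
        + (1 + q)⁻¹ * (1 - (1 + p)⁻¹ ^ 4) * (1 - (1 + p)⁻¹ ^ 4 * (1 + q)⁻¹ ^ 4)) =
      2 * (1 + p) ^ 7 * (1 + q) ^ 5 + 2 * (1 + p) ^ 5 * (1 + q) ^ 5 + 2 * (1 + p) ^ 3 * (1 + q)
        - 2 * (1 + p) * (1 + q) + 4 * (1 + p) ^ 5 * (1 + q) - 4 * (1 + p) ^ 6 * (1 + q) ^ 4
        - 4 * (1 + p) ^ 6 * (1 + q) ^ 2 + (1 + p) ^ 8 * (1 + q) ^ 4
        - (1 + p) ^ 4 * (1 + q) ^ 4 - (1 + p) ^ 4 + 1 := by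
    field_simp
    ring
  rw [e]
  ring_nf
  positivity

/-- This is AM-GM for 1, r², …, r^{2n}, whose geometric mean is r^n, with the geometric sum
multiplied out. -/
theorem natCast_mul_one_sub_sq_mul_pow_le {r : ℝ} (hr : 0 ≤ r) (hr1 : r ≤ 1) (n : ℕ) :
    ((n : ℝ) + 1) * (1 - r ^ 2) * r ^ (n + 1) ≤ (1 - (r ^ (n + 1)) ^ 2) * r := by
  induction n with
  | zero => simp
  | succ n ih =>
    have hv0 : 0 ≤ r ^ (n + 1) := by positivity
    have hv1 : r ^ (n + 1) ≤ 1 := pow_le_one₀ hr hr1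
    rw [pow_succ r (n + 1)]
    set v := r ^ (n + 1)
    -- This product is exactly the slack between the new inequality and r times the induction
    -- hypothesis.
    have h3 : 0 ≤ r * ((1 - r) * (1 - v) * (1 - r * v)) := by
      have : r * v ≤ 1 := mul_le_one₀ hr1 hv0 hv1
      have a1 := sub_nonneg.2 this
      have a2 := sub_nonneg.2 hr1
      have a3 := sub_nonneg.2 hv1
      positivity
    push_cast
    nlinarith [mul_le_mul_of_nonneg_right ih hr]

/-- The mean of the geometric distribution with ratio `s⁻²` truncated to `{0, ..., N - 1}`. -/
noncomputable def truncGeomMean (s : ℝ) (N : ℕ) : ℝ := N / (1 - s ^ (2 * N)) - 1 / (1 - s ^ 2)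

theorem truncGeomMean_step {r : ℝ} (hr : 0 < r) (hr1 : r < 1) (n : ℕ) :
    1 - 1 / 2 * (r ^ 2) ^ (n + 1) * (1 + ((n : ℝ) + 1) * (1 - r ^ 2) / 2) <
      truncGeomMean (r ^ 2) (n + 2) - truncGeomMean (r ^ 2) (n + 1) := by
  have hM := natCast_mul_one_sub_sq_mul_pow_le hr.le hr1.le n
  have hv0 : 0 < r ^ (n + 1) := by positivity
  have hv1 : r ^ (n + 1) < 1 := pow_lt_one₀ hr.le hr1 (by simp)
  have hE := step_polynomial_pos hv0 hv1 hr hr1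
  have e1 : (r ^ 2) ^ (n + 1) = (r ^ (n + 1)) ^ 2 := by ring
  have e2 : (r ^ 2) ^ (2 * (n + 1)) = (r ^ (n + 1)) ^ 4 := by ring
  have e3 : (r ^ 2) ^ (2 * (n + 2)) = (r ^ (n + 1)) ^ 4 * r ^ 4 := by ring
  simp only [truncGeomMean, e1, e2, e3]
  push_cast
  generalize r ^ (n + 1) = v at *
  have hN : (0 : ℝ) < n + 1 := by positivity
  have hn2 : (n : ℝ) + 2 = (n + 1) + 1 := by ring
  rw [hn2]
  generalize (n : ℝ) + 1 = N at *
  have hr4 : r ^ 4 < 1 := pow_lt_one₀ hr.le hr1 (by simp)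
  have hr2 : r ^ 2 < 1 := pow_lt_one₀ hr.le hr1 (by simp)
  have hv4 : v ^ 4 < 1 := pow_lt_one₀ hv0.le hv1 (by simp)
  have hv2 : v ^ 2 < 1 := pow_lt_one₀ hv0.le hv1 (by simp)
  have hvr : v ^ 4 * r ^ 4 < 1 := mul_lt_one_of_nonneg_of_lt_one_left (by positivity) hv4 hr4.le
  have p1 : 0 < 1 - v ^ 4 := by linarith
  have p2 : 0 < 1 - v ^ 4 * r ^ 4 := by linarith
  have p3 : 0 < 1 - v ^ 2 := by linarith
  have key : N * (1 - r ^ 2) * (4 * v ^ 2 * (1 + r ^ 2) - (1 - v ^ 4) * (1 - v ^ 4 * r ^ 4)) <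
      2 * ((1 - v ^ 4) * (1 - v ^ 4 * r ^ 4)) + 4 * v ^ 2 * r ^ 4 * (1 - v ^ 4) := by
    have hR : 0 < 2 * ((1 - v ^ 4) * (1 - v ^ 4 * r ^ 4)) + 4 * v ^ 2 * r ^ 4 * (1 - v ^ 4) := by
      positivity
    have hM0 : 0 ≤ N * (1 - r ^ 2) := mul_nonneg hN.le (by linarith)
    -- The upper bound on N helps only if its coefficient is positive; otherwise the left side is
    -- already nonpositive. In the positive case, multiplying by v brings in `hM`, and the factor 1
    -- - v² cancels to leave `hE`.
    rcases le_or_gt (4 * v ^ 2 * (1 + r ^ 2) - (1 - v ^ 4) * (1 - v ^ 4 * r ^ 4)) 0 with hB | hB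
    · exact (mul_nonpos_of_nonneg_of_nonpos hM0 hB).trans_lt hR
    · refine lt_of_mul_lt_mul_right ?_ hv0.le
      have h1 := mul_le_mul_of_nonneg_right hM hB.le
      have h2 := mul_pos p3 hE
      nlinarith
  have key2 : 4 * v ^ 2 * (N * (1 - r ^ 4) - r ^ 4 * (1 - v ^ 4)) <
      (1 - v ^ 4) * (1 - v ^ 4 * r ^ 4) * (2 + N * (1 - r ^ 2)) := by
    linear_combination key
  have e : (N + 1) / (1 - v ^ 4 * r ^ 4) - 1 / (1 - (r ^ 2) ^ 2)
      - (N / (1 - v ^ 4) - 1 / (1 - (r ^ 2) ^ 2)) - (1 - 1 / 2 * v ^ 2 * (1 + N * (1 - r ^ 2) / 2))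
      = v ^ 2 / 4 * ((1 - v ^ 4) * (1 - v ^ 4 * r ^ 4) * (2 + N * (1 - r ^ 2))
        - 4 * v ^ 2 * (N * (1 - r ^ 4) - r ^ 4 * (1 - v ^ 4)))
        / ((1 - v ^ 4) * (1 - v ^ 4 * r ^ 4)) := by
    rw [sub_sub_sub_cancel_right]
    field_simp
    ring
  rw [← sub_pos, e]
  have := sub_pos.2 key2
  positivity

theorem sum_lt_truncGeomMean {r : ℝ} (hr : 0 < r) (hr1 : r < 1) (n : ℕ) :
    ∑ d ∈ Finset.range (n + 1), (1 - 1 / 2 * (r ^ 2) ^ (d + 1) * (1 + ((d : ℝ) + 1) * (1 - r ^ 2) / 2))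
      < truncGeomMean (r ^ 2) (n + 2) := by
  induction n with
  | zero =>
    -- The telescoping starts from zero: with a single possible value the truncated mean vanishes.
    have := truncGeomMean_step hr hr1 0
    simp [truncGeomMean] at this ⊢
    linarith
  | succ n ih =>
    rw [Finset.sum_range_succ]
    have := truncGeomMean_step hr hr1 (n + 1)
    push_cast at this ⊢
    linarith

/-- The quarter makes r² = e^{-c/2} the Laplace decay per unit of rank and r⁴ = e^{-c} the inverse
ratio of the sampling weights. -/
theorem truncGeomMean_exp {c : ℝ} (hc : 0 < c) (N : ℕ) (hN : 1 ≤ N) :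
    ∑ k ∈ Finset.range N, (k : ℝ) * (Real.exp (c * k) / ∑ k' ∈ Finset.range N, Real.exp (c * k'))
      = truncGeomMean (Real.exp (-(c / 4)) ^ 2) N := by
  have hQ : 1 < Real.exp c := Real.one_lt_exp_iff.2 hc
  have hq : (Real.exp (-(c / 4)) ^ 2) ^ 2 = (Real.exp c)⁻¹ := by
    rw [← Real.exp_nat_mul, ← Real.exp_nat_mul, ← Real.exp_neg]; congr 1; push_cast; ring
  have he : ∀ k : ℕ, Real.exp (c * k) = Real.exp c ^ k := fun k => by
    rw [← Real.exp_nat_mul, mul_comm]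
  simp only [truncGeomMean, pow_mul, hq, he]
  generalize Real.exp c = Q at *
  have h0 : Q ≠ 0 := by positivity
  have h1 : Q - 1 ≠ 0 := by linarith
  have hQN : 1 < Q ^ N := one_lt_pow₀ hQ (by omega)
  have h2 : Q ^ N - 1 ≠ 0 := by linarith
  have hs : ∀ n : ℕ, ∑ k ∈ Finset.range n, (k : ℝ) * Q ^ k
      = (n * Q ^ n * (Q - 1) - Q * (Q ^ n - 1)) / (Q - 1) ^ 2 := by
    intro n
    induction n with
    | zero => simp
    | succ n ih =>
      rw [Finset.sum_range_succ, ih]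
      push_cast
      field_simp
      ring
  simp only [← mul_div_assoc]
  rw [← Finset.sum_div, hs, geom_sum_eq (by linarith)]
  have h3 : 1 - Q⁻¹ ^ N = (Q ^ N - 1) / Q ^ N := by
    rw [inv_pow]; field_simp
  have h4 : 1 - Q⁻¹ = (Q - 1) / Q := by field_simp
  rw [h3, h4]
  field_simp

/-! ### Laplace noise: distribution of differences and expected concordance -/

theorem laplaceMeasure_inv {a : ℝ} (ha : 0 < a) :
    laplaceMeasure a⁻¹ =
      volume.withDensity fun x => ENNReal.ofReal (a / 2 * Real.exp (-(a * |x|))) := by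
  unfold laplaceMeasure
  congr 1
  ext x
  congr 2
  · field_simp
  · congr 1; field_simp

theorem laplaceMeasure_Iic_of_nonpos {a z : ℝ} (ha : 0 < a) (hz : z ≤ 0) :
    laplaceMeasure a⁻¹ (Set.Iic z) = ENNReal.ofReal (1 / 2 * Real.exp (a * z)) := by
  rw [laplaceMeasure_inv ha, withDensity_apply _ measurableSet_Iic,
    setLIntegral_congr_fun (g := fun x => ENNReal.ofReal (a / 2 * Real.exp (a * x)))
      measurableSet_Iic,
    ← ofReal_integral_eq_lintegral_ofReal ((integrableOn_exp_mul_Iic ha z).const_mul _)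
      (Filter.Eventually.of_forall fun x => by positivity),
    integral_const_mul, integral_exp_mul_Iic ha]
  · congr 1; field_simp
  · intro x hx
    simp only [abs_of_nonpos (le_trans hx hz), mul_neg, neg_neg]

theorem laplaceMeasure_Ioi_of_nonneg {a z : ℝ} (ha : 0 < a) (hz : 0 ≤ z) :
    laplaceMeasure a⁻¹ (Set.Ioi z) = ENNReal.ofReal (1 / 2 * Real.exp (-a * z)) := by
  rw [laplaceMeasure_inv ha, withDensity_apply _ measurableSet_Ioi,
    setLIntegral_congr_fun (g := fun x => ENNReal.ofReal (a / 2 * Real.exp (-a * x)))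
      measurableSet_Ioi,
    ← ofReal_integral_eq_lintegral_ofReal
      ((integrableOn_exp_mul_Ioi (neg_lt_zero.2 ha) z).const_mul _)
      (Filter.Eventually.of_forall fun x => by positivity),
    integral_const_mul, integral_exp_mul_Ioi (neg_lt_zero.2 ha)]
  · congr 1; field_simp
  · intro x hx
    simp only [abs_of_pos (lt_of_le_of_lt hz hx), neg_mul]

theorem isProbabilityMeasure_laplaceMeasure {a : ℝ} (ha : 0 < a) :
    IsProbabilityMeasure (laplaceMeasure a⁻¹) := by
  constructor
  rw [← Set.Iic_union_Ioi (a := (0 : ℝ)),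
    measure_union (Set.Iic_disjoint_Ioi le_rfl) measurableSet_Ioi,
    laplaceMeasure_Iic_of_nonpos ha le_rfl, laplaceMeasure_Ioi_of_nonneg ha le_rfl,
    ← ENNReal.ofReal_add (by positivity) (by positivity)]
  norm_num

theorem laplaceMeasure_Iic_of_nonneg {a z : ℝ} (ha : 0 < a) (hz : 0 ≤ z) :
    laplaceMeasure a⁻¹ (Set.Iic z) = ENNReal.ofReal (1 - 1 / 2 * Real.exp (-a * z)) := by
  have := isProbabilityMeasure_laplaceMeasure ha
  rw [← Set.compl_Ioi, prob_compl_eq_one_sub measurableSet_Ioi, laplaceMeasure_Ioi_of_nonneg ha hz,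
    ENNReal.ofReal_sub _ (by positivity), ENNReal.ofReal_one]

/-- Conditioning on the first coordinate y, the ranges y ≤ 0, 0 < y ≤ d and y > d contribute 1/8,
ad/4 and 3/8 times e^{-ad}. On the middle range the integrand is constant, which produces the linear
term. -/
theorem laplaceMeasure_prod_le_sub {a d : ℝ} (ha : 0 < a) (hd : 0 ≤ d) :
    ((laplaceMeasure a⁻¹).prod (laplaceMeasure a⁻¹)) {p | p.2 ≤ p.1 - d} =
      ENNReal.ofReal (1 / 2 * Real.exp (-a * d) * (1 + a * d / 2)) := by
  have := isProbabilityMeasure_laplaceMeasure ha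
  have hm : Measurable fun y : ℝ => laplaceMeasure a⁻¹ (Set.Iic (y - d)) :=
    measurable_measure_prodMk_left (measurableSet_le (by fun_prop) (by fun_prop) :
      MeasurableSet {p : ℝ × ℝ | p.2 ≤ p.1 - d})
  rw [Measure.prod_apply (measurableSet_le (by fun_prop) (by fun_prop))]
  change ∫⁻ y, laplaceMeasure a⁻¹ (Set.Iic (y - d)) ∂(laplaceMeasure a⁻¹) = _
  nth_rw 1 [laplaceMeasure_inv ha]
  rw [lintegral_withDensity_eq_lintegral_mul _ (by fun_prop) hm]
  simp only [Pi.mul_apply]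
  rw [← setLIntegral_univ, ← Set.Iic_union_Ioi (a := (0 : ℝ)),
    lintegral_union measurableSet_Ioi (Set.Iic_disjoint_Ioi le_rfl),
    ← Set.Ioc_union_Ioi_eq_Ioi hd,
    lintegral_union measurableSet_Ioi (Set.Ioc_disjoint_Ioi le_rfl)]
  have h1 : ∫⁻ y in Set.Iic 0, ENNReal.ofReal (a / 2 * Real.exp (-(a * |y|))) *
      laplaceMeasure a⁻¹ (Set.Iic (y - d)) = ENNReal.ofReal (Real.exp (-a * d) / 8) := by
    rw [setLIntegral_congr_fun
        (g := fun y => ENNReal.ofReal (a / 4 * Real.exp (-a * d) * Real.exp ((2 * a) * y)))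
        measurableSet_Iic,
      ← ofReal_integral_eq_lintegral_ofReal
        ((integrableOn_exp_mul_Iic (by positivity) 0).const_mul _)
        (Filter.Eventually.of_forall fun x => by positivity),
      integral_const_mul, integral_exp_mul_Iic (by positivity)]
    · congr 1; rw [mul_zero, Real.exp_zero]; field_simp; ring
    · intro y hy
      have hy : y ≤ 0 := hy
      simp only []
      rw [laplaceMeasure_Iic_of_nonpos ha (by linarith), ← ENNReal.ofReal_mul (by positivity),
        abs_of_nonpos hy]
      congr 1
      rw [mul_mul_mul_comm, ← Real.exp_add, mul_assoc (a / 4), ← Real.exp_add]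
      congr 1
      · ring
      · congr 1; ring
  have h2 : ∫⁻ y in Set.Ioc 0 d, ENNReal.ofReal (a / 2 * Real.exp (-(a * |y|))) *
      laplaceMeasure a⁻¹ (Set.Iic (y - d)) = ENNReal.ofReal (a / 4 * Real.exp (-a * d) * d) := by
    rw [setLIntegral_congr_fun (g := fun y => ENNReal.ofReal (a / 4 * Real.exp (-a * d)))
        measurableSet_Ioc, setLIntegral_const, Real.volume_Ioc, sub_zero,
        ← ENNReal.ofReal_mul (by positivity)]
    · intro y hy
      simp only []
      rw [laplaceMeasure_Iic_of_nonpos ha (by linarith [hy.2]),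
        ← ENNReal.ofReal_mul (by positivity), abs_of_pos hy.1]
      congr 1
      rw [mul_mul_mul_comm, ← Real.exp_add]
      congr 1
      · ring
      · congr 1; ring
  have h3 : ∫⁻ y in Set.Ioi d, ENNReal.ofReal (a / 2 * Real.exp (-(a * |y|))) *
      laplaceMeasure a⁻¹ (Set.Iic (y - d)) = ENNReal.ofReal (3 / 8 * Real.exp (-a * d)) := by
    have i1 := (integrableOn_exp_mul_Ioi (neg_lt_zero.2 ha) d).const_mul (a / 2)
    have ha2 : -(2 * a) < 0 := by linarith
    have i2 := (integrableOn_exp_mul_Ioi ha2 d).const_mul (a / 4 * Real.exp (a * d))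
    have i12 : Integrable (fun y => a / 2 * Real.exp (-a * y) -
        a / 4 * Real.exp (a * d) * Real.exp (-(2 * a) * y)) (volume.restrict (Set.Ioi d)) := i1.sub i2
    have hg : Set.EqOn (fun y => ENNReal.ofReal (a / 2 * Real.exp (-(a * |y|))) *
        laplaceMeasure a⁻¹ (Set.Iic (y - d)))
        (fun y => ENNReal.ofReal (a / 2 * Real.exp (-a * y) -
          a / 4 * Real.exp (a * d) * Real.exp (-(2 * a) * y))) (Set.Ioi d) := by
      intro y hy
      have hy : d < y := hy
      simp only []
      rw [laplaceMeasure_Iic_of_nonneg ha (by linarith),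
        ← ENNReal.ofReal_mul (by positivity), abs_of_pos (hd.trans_lt hy)]
      congr 1
      have e : Real.exp (a * d) * Real.exp (-(2 * a) * y) =
          Real.exp (-a * y) * Real.exp (-a * (y - d)) := by
        rw [← Real.exp_add, ← Real.exp_add]; congr 1; ring
      rw [mul_assoc (a / 4), e, neg_mul]
      ring_nf
    rw [setLIntegral_congr_fun measurableSet_Ioi hg,
      ← ofReal_integral_eq_lintegral_ofReal i12, integral_sub i1 i2,
      integral_const_mul, integral_const_mul, integral_exp_mul_Ioi (neg_lt_zero.2 ha),
      integral_exp_mul_Ioi ha2]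
    · congr 1
      have e : Real.exp (-(2 * a) * d) = Real.exp (-a * d) * Real.exp (-a * d) := by
        rw [← Real.exp_add]; congr 1; ring
      have e' : Real.exp (a * d) * Real.exp (-a * d) = 1 := by
        rw [← Real.exp_add, ← Real.exp_zero]; congr 1; ring
      have e'' : ∀ E F : ℝ, a / 2 * (-E / -a) - a / 4 * F * (-(E * E) / -(2 * a)) =
          E / 2 - F * E * E / 8 := fun E F => by field_simp; ring
      rw [e, e'', e']
      ring
    · filter_upwards [ae_restrict_mem measurableSet_Ioi] with y hy
      have hy : d < y := hy
      have e : Real.exp (a * d) * Real.exp (-(2 * a) * y) ≤ Real.exp (-a * y) := by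
        rw [← Real.exp_add]
        apply Real.exp_le_exp.2
        nlinarith
      have := Real.exp_pos (-a * y)
      simp only [Pi.zero_apply]
      nlinarith
  rw [h1, h2, h3, ← ENNReal.ofReal_add (by positivity) (by positivity),
    ← ENNReal.ofReal_add (by positivity) (by positivity)]
  congr 1
  ring

theorem laplaceMeasure_pi_sub_lt {m : ℕ} {a d : ℝ} (ha : 0 < a) (hd : 0 ≤ d) {i j : Fin m}
    (hij : i ≠ j) :
    (Measure.pi fun _ : Fin m => laplaceMeasure a⁻¹).real {ξ | ξ i - ξ j < d} =
      1 - 1 / 2 * Real.exp (-a * d) * (1 + a * d / 2) := by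
  have := isProbabilityMeasure_laplaceMeasure ha
  have hI := ((ProbabilityTheory.iIndepFun_pi (μ := fun _ : Fin m => laplaceMeasure a⁻¹)
    (X := fun _ x => x) fun _ => by fun_prop).indepFun hij).map_prod_eq_prod_map_map
      (measurable_pi_apply i).aemeasurable (measurable_pi_apply j).aemeasurable
  rw [(measurePreserving_eval _ i).map_eq, (measurePreserving_eval _ j).map_eq] at hI
  have h := laplaceMeasure_prod_le_sub ha hd
  have hS : MeasurableSet {p : ℝ × ℝ | p.2 ≤ p.1 - d} :=
    measurableSet_le (by fun_prop) (by fun_prop)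
  rw [← hI, Measure.map_apply (by fun_prop) hS] at h
  have hc : {ξ : Fin m → ℝ | ξ i - ξ j < d} =
      ((fun ξ : Fin m → ℝ => (ξ i, ξ j)) ⁻¹' {p : ℝ × ℝ | p.2 ≤ p.1 - d})ᶜ := by
    ext ξ
    simp only [Set.mem_ofPred_eq, Set.mem_compl_iff, Set.mem_preimage, not_le]
    constructor <;> intro <;> linarith
  rw [hc, probReal_compl_eq_one_sub (hS.preimage (by fun_prop)), measureReal_def, h,
    ENNReal.toReal_ofReal (by positivity)]

/-- The probability that the Laplace mechanism with scale `a⁻¹` preserves the order of two items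
whose ranks differ by `d`. -/
noncomputable def laplaceConcordance (a d : ℝ) : ℝ :=
  if d = 0 then 0 else 1 - 1 / 2 * Real.exp (-a * |d|) * (1 + a * |d| / 2)

theorem integral_concordantPairs_laplaceMechanism {m : ℕ} {a : ℝ} (ha : 0 < a) (φ : Ranking m) :
    ∫ y, concordantPairs φ.toVec y ∂(laplaceMechanism a⁻¹ φ) =
      ∑ i, ∑ j, laplaceConcordance a (φ.toVec i - φ.toVec j) := by
  have := isProbabilityMeasure_laplaceMeasure ha
  have hS : ∀ i j, MeasurableSet {ξ : Fin m → ℝ |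
      0 < (φ.toVec i - φ.toVec j) * ((φ.toVec i + ξ i) - (φ.toVec j + ξ j))} := fun i j =>
    measurableSet_lt (by fun_prop) (by fun_prop)
  have hind : ∀ i j, (fun ξ : Fin m → ℝ =>
      if 0 < (φ.toVec i - φ.toVec j) * ((φ.toVec i + ξ i) - (φ.toVec j + ξ j)) then (1 : ℝ) else 0)
      = Set.indicator {ξ : Fin m → ℝ |
      0 < (φ.toVec i - φ.toVec j) * ((φ.toVec i + ξ i) - (φ.toVec j + ξ j))} 1 := by
    intro i j
    ext ξ
    simp [Set.indicator_apply]
  unfold laplaceMechanism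
  rw [integral_map (by fun_prop : Measurable _).aemeasurable]
  · unfold concordantPairs
    have hint : ∀ i j, Integrable (fun ξ : Fin m → ℝ =>
        if 0 < (φ.toVec i - φ.toVec j) * ((φ.toVec i + ξ i) - (φ.toVec j + ξ j))
          then (1 : ℝ) else 0) (Measure.pi fun _ : Fin m => laplaceMeasure a⁻¹) := by
      intro i j
      rw [hind]
      exact (integrable_const (1 : ℝ)).indicator (hS i j)
    rw [integral_finsetSum _ fun i _ => integrable_finsetSum _ fun j _ => hint i j]
    refine Finset.sum_congr rfl fun i _ => ?_
    rw [integral_finsetSum _ fun j _ => hint i j]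
    refine Finset.sum_congr rfl fun j _ => ?_
    rw [hind, integral_indicator_one (hS i j), laplaceConcordance]
    rcases lt_trichotomy (φ.toVec i - φ.toVec j) 0 with h | h | h
    · have hij : i ≠ j := by rintro rfl; simp at h
      rw [if_neg h.ne, abs_of_neg h, ← laplaceMeasure_pi_sub_lt ha (by linarith) hij]
      congr 1
      ext ξ
      simp only [Set.mem_ofPred_eq, mul_pos_iff, h, h.not_gt, false_and, true_and, false_or]
      constructor <;> intro <;> linarith
    · simp [h]
    · have hij : j ≠ i := by rintro rfl; simp at h
      rw [if_neg h.ne', abs_of_pos h, ← laplaceMeasure_pi_sub_lt ha h.le hij]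
      congr 1
      ext ξ
      simp only [Set.mem_ofPred_eq, mul_pos_iff_of_pos_left h]
      constructor <;> intro <;> linarith
  · refine Measurable.aestronglyMeasurable ?_
    unfold concordantPairs
    exact Finset.measurable_sum _ fun i _ => Finset.measurable_sum _ fun j _ =>
      Measurable.ite (measurableSet_lt (by fun_prop) (by fun_prop)) (by fun_prop) (by fun_prop)

/-! ### Insertion: invariant and number of new concordant pairs -/

/-- After the items of rank at most `n` have been processed, they hold the synthetic ranks
`1, ..., n`. -/
structure AlgState.IsRanked {m : ℕ} (φ : Ranking m) (n : ℕ) (s : AlgState m) : Prop where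
  mem_processed : ∀ l, l ∈ s.processed ↔ (φ l : ℕ) ≤ n
  card_synth_le : ∀ k ≤ n, (s.processed.filter fun l => s.synth l ≤ k).card = k

/-- The number of concordant ordered pairs of processed items. -/
noncomputable def AlgState.concordant {m : ℕ} (φ : Ranking m) (s : AlgState m) : ℝ :=
  ∑ i ∈ s.processed, ∑ j ∈ s.processed,
    if 0 < (φ.toVec i - φ.toVec j) * ((s.synth i : ℝ) - s.synth j) then 1 else 0

theorem AlgState.concordant_nonneg {m : ℕ} (φ : Ranking m) (s : AlgState m) :
    0 ≤ s.concordant φ :=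
  Finset.sum_nonneg fun _ _ => Finset.sum_nonneg fun _ _ => by split_ifs <;> norm_num

theorem natCast_add_half_lt {a v : ℕ} : (v : ℝ) + 1 / 2 < a ↔ v < a := by
  constructor
  · intro h
    by_contra hc
    have : (a : ℝ) ≤ v := by exact_mod_cast not_lt.1 hc
    linarith
  · intro h
    have : (v : ℝ) + 1 ≤ a := by exact_mod_cast h
    linarith

theorem lt_natCast_add_half {a v : ℕ} : (a : ℝ) < v + 1 / 2 ↔ a ≤ v := by
  constructor
  · intro h
    by_contra hc
    have : (v : ℝ) + 1 ≤ a := by exact_mod_cast not_le.1 hc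
    linarith
  · intro h
    have : (a : ℝ) ≤ v := by exact_mod_cast h
    linarith

theorem tau_eq {m : ℕ} {φ : Ranking m} {n : ℕ} {s : AlgState m} (hs : s.IsRanked φ n) {k : ℕ}
    (hk : k ≤ n) : tau φ (n + 1) s k = k := by
  rw [tau]
  conv_rhs => rw [← hs.card_synth_le k hk, Finset.card_filter]
  push_cast
  refine Finset.sum_congr rfl fun l hl => ?_
  have h1 : ((φ l : ℕ) : ℝ) ≤ n := by exact_mod_cast (hs.mem_processed l).1 hl
  have h2 : (0 : ℝ) < (n : ℝ) + 1 - ((φ l : ℕ) : ℝ) := by linarith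
  simp only [mul_pos_iff_of_pos_left h2, sub_pos, lt_natCast_add_half]

section Insert

variable {m : ℕ} {φ : Ranking m} {n : ℕ} {s : AlgState m} {j : Fin m} {v : ℕ}

theorem insertItem_synth_self : (insertItem s j v).synth j = v + 1 := by
  simp [insertItem]

theorem insertItem_synth_of_mem {i : Fin m} (hj : j ∉ s.processed) (hi : i ∈ s.processed) :
    (insertItem s j v).synth i = if v < s.synth i then s.synth i + 1 else s.synth i := by
  have hij : i ≠ j := fun h => hj (h ▸ hi)
  simp only [insertItem, hij, if_false, hi, true_and, natCast_add_half_lt]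

theorem AlgState.IsRanked.insertItem (hs : s.IsRanked φ n) (hj : (φ j : ℕ) = n + 1) (hv : v ≤ n) :
    (insertItem s j v).IsRanked φ (n + 1) := by
  have hjs : j ∉ s.processed := by rw [hs.mem_processed]; omega
  constructor
  · intro l
    change l ∈ insert j s.processed ↔ _
    rw [Finset.mem_insert, hs.mem_processed]
    constructor
    · rintro (rfl | h) <;> omega
    · intro h
      by_cases h' : (φ l : ℕ) ≤ n
      · exact Or.inr h'
      · exact Or.inl (φ.injective (Subtype.ext (by omega)))
  · intro k hk
    change ((insert j s.processed).filter _).card = k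
    rw [Finset.filter_insert, insertItem_synth_self]
    rcases le_or_gt k v with hkv | hkv
    · rw [if_neg (by omega)]
      refine Eq.trans ?_ (hs.card_synth_le k (by omega))
      congr 1
      refine Finset.filter_congr fun l hl => ?_
      rw [insertItem_synth_of_mem hjs hl]
      split_ifs <;> omega
    · rw [if_pos (by omega), Finset.card_insert_of_notMem (by simp [hjs])]
      have h := hs.card_synth_le (k - 1) (by omega)
      have e : (s.processed.filter fun l => (_root_.insertItem s j v).synth l ≤ k) =
          s.processed.filter fun l => s.synth l ≤ k - 1 := by
        refine Finset.filter_congr fun l hl => ?_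
        rw [insertItem_synth_of_mem hjs hl]
        split_ifs <;> omega
      rw [e, h]
      omega

/-- The shift preserves the order of the processed items. The new item has the largest true rank, so
it agrees exactly with the v items at synthetic positions up to v, each counted in both orders. -/
theorem AlgState.IsRanked.concordant_insertItem (hs : s.IsRanked φ n) (hj : (φ j : ℕ) = n + 1)
    (hv : v ≤ n) : (_root_.insertItem s j v).concordant φ = s.concordant φ + 2 * v := by
  have hjs : j ∉ s.processed := by rw [hs.mem_processed]; omega
  have hφ : ∀ l ∈ s.processed, φ.toVec l < φ.toVec j := fun l hl => by
    have := (hs.mem_processed l).1 hl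
    simp only [Ranking.toVec]
    exact_mod_cast (by omega : (φ l : ℕ) < φ j)
  have hcount : (∑ l ∈ s.processed, if s.synth l ≤ v then (1 : ℝ) else 0) = v := by
    conv_rhs => rw [← hs.card_synth_le v hv, Finset.card_filter]
    push_cast
    rfl
  have h1 : ∀ l ∈ s.processed, (0 < (φ.toVec j - φ.toVec l) *
      (((_root_.insertItem s j v).synth j : ℝ) - (_root_.insertItem s j v).synth l)) ↔
      s.synth l ≤ v := by
    intro l hl
    rw [mul_pos_iff_of_pos_left (sub_pos.2 (hφ l hl)), sub_pos, Nat.cast_lt,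
      insertItem_synth_self, insertItem_synth_of_mem hjs hl]
    split_ifs <;> omega
  have h2 : ∀ l ∈ s.processed, (0 < (φ.toVec l - φ.toVec j) *
      (((_root_.insertItem s j v).synth l : ℝ) - (_root_.insertItem s j v).synth j)) ↔
      s.synth l ≤ v := by
    intro l hl
    rw [← h1 l hl, ← neg_sub (φ.toVec j), ← neg_sub ((_root_.insertItem s j v).synth j : ℝ),
      neg_mul_neg]
  have h3 : ∀ i ∈ s.processed, ∀ l ∈ s.processed, (0 < (φ.toVec i - φ.toVec l) *
      (((_root_.insertItem s j v).synth i : ℝ) - (_root_.insertItem s j v).synth l)) ↔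
      0 < (φ.toVec i - φ.toVec l) * ((s.synth i : ℝ) - s.synth l) := by
    intro i hi l hl
    have mono : ∀ i ∈ s.processed, ∀ l ∈ s.processed,
        (_root_.insertItem s j v).synth i < (_root_.insertItem s j v).synth l ↔
        s.synth i < s.synth l := by
      intro i hi l hl
      rw [insertItem_synth_of_mem hjs hi, insertItem_synth_of_mem hjs hl]
      split_ifs <;> omega
    simp only [mul_pos_iff, sub_pos, sub_neg, Nat.cast_lt, mono i hi l hl, mono l hl i hi]
  unfold AlgState.concordant
  change ∑ i ∈ insert j s.processed, ∑ l ∈ insert j s.processed, _ = _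
  rw [Finset.sum_insert hjs, Finset.sum_insert hjs, sub_self, zero_mul, if_neg (lt_irrefl _),
    zero_add, Finset.sum_congr rfl fun l hl => if_congr (h1 l hl) rfl rfl, hcount]
  have : ∀ i ∈ s.processed, (∑ l ∈ insert j s.processed, if 0 < (φ.toVec i - φ.toVec l) *
      (((_root_.insertItem s j v).synth i : ℝ) - (_root_.insertItem s j v).synth l)
        then (1 : ℝ) else 0) = (if s.synth i ≤ v then (1 : ℝ) else 0) + ∑ l ∈ s.processed,
      if 0 < (φ.toVec i - φ.toVec l) * ((s.synth i : ℝ) - s.synth l) then (1 : ℝ) else 0 := by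
    intro i hi
    rw [Finset.sum_insert hjs, if_congr (h2 i hi) rfl rfl,
      Finset.sum_congr rfl fun l hl => if_congr (h3 i hi l hl) rfl rfl]
  rw [Finset.sum_congr rfl this, Finset.sum_add_distrib, hcount]
  ring

end Insert

/-! ### Expected concordance of the algorithm -/

/-- The mean of the value sampled in the iteration with `N` possible values. -/
noncomputable def positionMean (c : ℝ) (N : ℕ) : ℝ :=
  ∑ k ∈ Finset.range N, (k : ℝ) * (Real.exp (c * k) / ∑ k' ∈ Finset.range N, Real.exp (c * k'))

theorem positionMean_nonneg (c : ℝ) (N : ℕ) : 0 ≤ positionMean c N :=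
  Finset.sum_nonneg fun _ _ => by positivity

theorem positionPMF_apply {m : ℕ} (φ : Ranking m) (ε : ℝ) {t : ℕ} (ht : 1 ≤ t) (s : AlgState m)
    (v : ℕ) : positionPMF φ ε ht s v = positionProb φ ε t s v := rfl

theorem positionProb_eq {m : ℕ} {φ : Ranking m} {ε : ℝ} {n : ℕ} {s : AlgState m}
    (hs : s.IsRanked φ n) {k : ℕ} (hk : k ∈ Finset.range (n + 1)) :
    positionProb φ ε (n + 1) s k = ENNReal.ofReal (Real.exp (ε * ((m : ℝ) - 1)⁻¹ * k) /
      ∑ k' ∈ Finset.range (n + 1), Real.exp (ε * ((m : ℝ) - 1)⁻¹ * k')) := by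
  have h : ∀ k ∈ Finset.range (n + 1),
      positionWeight φ ε (n + 1) s k = Real.exp (ε * ((m : ℝ) - 1)⁻¹ * k) := fun k hk => by
    rw [positionWeight, tau_eq hs (Nat.lt_succ_iff.1 (Finset.mem_range.1 hk))]
  rw [positionProb, if_pos hk, h k hk, Finset.sum_congr rfl h]

theorem tsum_positionPMF_mul_concordant {m : ℕ} {φ : Ranking m} {ε : ℝ} {n : ℕ} {s : AlgState m}
    (hs : s.IsRanked φ n) {j : Fin m} (hj : (φ j : ℕ) = n + 1) (ht : 1 ≤ n + 1) :
    ∑' v, positionPMF φ ε ht s v * ENNReal.ofReal ((insertItem s j v).concordant φ) =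
      ENNReal.ofReal (s.concordant φ) +
        ENNReal.ofReal (2 * positionMean (ε * ((m : ℝ) - 1)⁻¹) (n + 1)) := by
  have hC := s.concordant_nonneg φ
  rw [tsum_eq_sum (s := Finset.range (n + 1))]
  · have hterm : ∀ v ∈ Finset.range (n + 1),
        positionPMF φ ε ht s v * ENNReal.ofReal ((insertItem s j v).concordant φ) =
        ENNReal.ofReal (Real.exp (ε * ((m : ℝ) - 1)⁻¹ * v) /
          (∑ k' ∈ Finset.range (n + 1), Real.exp (ε * ((m : ℝ) - 1)⁻¹ * k')) *
            (s.concordant φ + 2 * v)) := by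
      intro v hv
      rw [hs.concordant_insertItem hj (Nat.lt_succ_iff.1 (Finset.mem_range.1 hv)), positionPMF_apply,
        positionProb_eq hs hv, ← ENNReal.ofReal_mul (by positivity)]
    rw [Finset.sum_congr rfl hterm, ← ENNReal.ofReal_sum_of_nonneg fun v _ => by positivity,
      ← ENNReal.ofReal_add hC (mul_nonneg two_pos.le (positionMean_nonneg _ _))]
    congr 1
    simp only [mul_add, Finset.sum_add_distrib, ← Finset.sum_mul, positionMean]
    rw [← Finset.sum_div, div_self, one_mul, Finset.mul_sum]
    · congr 1
      exact Finset.sum_congr rfl fun _ _ => by ring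
    · exact (Finset.sum_pos (fun _ _ => Real.exp_pos _) ⟨0, by simp⟩).ne'
  · intro v hv
    rw [positionPMF_apply, positionProb, if_neg hv, zero_mul]

theorem PMF.tsum_bind_mul {α β : Type*} (p : PMF α) (f : α → PMF β) (g : β → ENNReal) :
    ∑' b, p.bind f b * g b = ∑' a, p a * ∑' b, f a b * g b := by
  simp only [PMF.bind_apply, ← ENNReal.tsum_mul_right, ← ENNReal.tsum_mul_left, mul_assoc]
  exact ENNReal.tsum_comm

theorem PMF.tsum_pure_mul {α : Type*} (a : α) (g : α → ENNReal) :
    ∑' b, PMF.pure a b * g b = g a := by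
  rw [tsum_eq_single a]
  · simp
  · intro b hb
    simp [hb]

theorem PMF.tsum_map_mul {α β : Type*} (p : PMF α) (f : α → β) (g : β → ENNReal) :
    ∑' b, p.map f b * g b = ∑' a, p a * g (f a) := by
  rw [PMF.map, PMF.tsum_bind_mul]
  simp only [Function.comp, PMF.tsum_pure_mul]

theorem stateAfter_isRanked {m : ℕ} (φ : Ranking m) (ε : ℝ) (n : ℕ) (h : n + 1 ≤ m)
    (s : AlgState m) (hs : s ∈ (stateAfter φ ε n h).support) : s.IsRanked φ (n + 1) := by
  induction n generalizing s with
  | zero =>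
    simp only [stateAfter, PMF.support_pure, Set.mem_singleton_iff] at hs
    subst hs
    constructor
    · intro l
      simp only [Finset.mem_singleton, Equiv.eq_symm_apply, Subtype.ext_iff]
      have := (Finset.mem_Icc.1 (φ l).2).1
      omega
    · intro k hk
      rw [Finset.filter_singleton]
      interval_cases k <;> simp
  | succ n ih =>
    simp only [stateAfter, iteration, PMF.mem_support_bind_iff, PMF.mem_support_map_iff] at hs
    obtain ⟨s', hs', v, hv, rfl⟩ := hs
    refine (ih _ s' hs').insertItem (by simp) ?_
    by_contra hv'
    exact (PMF.mem_support_iff _ _).1 hv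
      (PMF.ofFinset_apply_of_notMem _ _ (by rw [Finset.mem_range]; omega))

theorem tsum_stateAfter_mul_concordant {m : ℕ} (φ : Ranking m) (ε : ℝ) (n : ℕ) (h : n + 1 ≤ m) :
    ∑' s, stateAfter φ ε n h s * ENNReal.ofReal (s.concordant φ) =
      ENNReal.ofReal (2 * ∑ k ∈ Finset.range n, positionMean (ε * ((m : ℝ) - 1)⁻¹) (k + 2)) := by
  induction n with
  | zero => simp [stateAfter, AlgState.concordant]
  | succ n ih =>
    have hmean : 0 ≤ ∑ k ∈ Finset.range n, positionMean (ε * ((m : ℝ) - 1)⁻¹) (k + 2) :=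
      Finset.sum_nonneg fun _ _ => positionMean_nonneg _ _
    have hstep : ∀ s, stateAfter φ ε n (Nat.le_of_succ_le h) s *
        (∑' s', iteration φ ε ⟨n + 2, Finset.mem_Icc.2 ⟨Nat.le_add_left 1 (n + 1), h⟩⟩ s s' *
          ENNReal.ofReal (s'.concordant φ)) =
        stateAfter φ ε n (Nat.le_of_succ_le h) s * (ENNReal.ofReal (s.concordant φ) +
          ENNReal.ofReal (2 * positionMean (ε * ((m : ℝ) - 1)⁻¹) (n + 2))) := by
      intro s
      -- The gain formula needs the ranking invariant, which holds on the support; other states have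
      -- weight zero.
      by_cases hs : s ∈ (stateAfter φ ε n (Nat.le_of_succ_le h)).support
      · congr 1
        rw [iteration, PMF.tsum_map_mul]
        exact tsum_positionPMF_mul_concordant (stateAfter_isRanked φ ε n _ s hs) (by simp) _
      · rw [(PMF.apply_eq_zero_iff _ _).2 hs, zero_mul, zero_mul]
    rw [stateAfter, PMF.tsum_bind_mul, tsum_congr hstep]
    simp only [mul_add]
    rw [ENNReal.tsum_add, ih, ENNReal.tsum_mul_right, PMF.tsum_coe, one_mul,
      ← ENNReal.ofReal_add (by positivity) (mul_nonneg two_pos.le (positionMean_nonneg _ _)),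
      Finset.sum_range_succ, mul_add]

theorem concordantPairs_nonneg {m : ℕ} (x y : Fin m → ℝ) : 0 ≤ concordantPairs x y :=
  Finset.sum_nonneg fun _ _ => Finset.sum_nonneg fun _ _ => by split_ifs <;> norm_num

theorem integral_concordantPairs_rankingAlgorithm {m : ℕ} (hm : 1 ≤ m) (ε : ℝ) (φ : Ranking m) :
    ∫ r, concordantPairs φ.toVec (fun i => (r i : ℝ)) ∂(rankingAlgorithm hm ε φ).toMeasure =
      2 * ∑ k ∈ Finset.range (m - 1), positionMean (ε * ((m : ℝ) - 1)⁻¹) (k + 2) := by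
  have hmean : 0 ≤ ∑ k ∈ Finset.range (m - 1), positionMean (ε * ((m : ℝ) - 1)⁻¹) (k + 2) :=
    Finset.sum_nonneg fun _ _ => positionMean_nonneg _ _
  rw [integral_eq_lintegral_of_nonneg_ae
    (Filter.Eventually.of_forall fun r => concordantPairs_nonneg _ _)
    (measurable_of_countable _).aestronglyMeasurable, lintegral_countable']
  have h1 : ∀ r : Fin m → ℕ, (rankingAlgorithm hm ε φ).toMeasure {r} = rankingAlgorithm hm ε φ r :=
    fun r => PMF.toMeasure_apply_singleton _ _ (measurableSet_singleton r)
  have h2 : ∀ s, stateAfter φ ε (m - 1) (Nat.sub_add_cancel hm).le s *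
      ENNReal.ofReal (concordantPairs φ.toVec fun i => (s.synth i : ℝ)) =
      stateAfter φ ε (m - 1) (Nat.sub_add_cancel hm).le s * ENNReal.ofReal (s.concordant φ) := by
    intro s
    by_cases hs : s ∈ (stateAfter φ ε (m - 1) (Nat.sub_add_cancel hm).le).support
    · have hall : s.processed = Finset.univ := by
        ext l
        have := (Finset.mem_Icc.1 (φ l).2).2
        simp only [(stateAfter_isRanked φ ε _ _ s hs).mem_processed, Finset.mem_univ, iff_true]
        omega
      rw [AlgState.concordant, hall, concordantPairs]
    · rw [(PMF.apply_eq_zero_iff _ _).2 hs, zero_mul, zero_mul]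
  simp only [h1, mul_comm (ENNReal.ofReal _)]
  rw [rankingAlgorithm, PMF.tsum_map_mul, tsum_congr h2, tsum_stateAfter_mul_concordant,
    ENNReal.toReal_ofReal (by positivity)]

/-! ### Regrouping by larger rank and final comparison -/

theorem sum_sum_Icc_symm (f : ℝ → ℝ) (h0 : f 0 = 0) (hf : ∀ x, f (-x) = f x) (n : ℕ) :
    ∑ a ∈ Finset.Icc 1 (n + 1), ∑ b ∈ Finset.Icc 1 (n + 1), f ((a : ℝ) - b) =
      2 * ∑ k ∈ Finset.range n, ∑ d ∈ Finset.range (k + 1), f ((d : ℝ) + 1) := by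
  induction n with
  | zero => simp [h0]
  | succ n ih =>
    have hlast : ∑ a ∈ Finset.Icc 1 (n + 1), f (((n + 1 + 1 : ℕ) : ℝ) - a) =
        ∑ d ∈ Finset.range (n + 1), f ((d : ℝ) + 1) := by
      rw [← Finset.sum_range_reflect, ← Finset.Ico_add_one_right_eq_Icc, Finset.sum_Ico_eq_sum_range]
      refine Finset.sum_congr rfl fun d hd => ?_
      have := Finset.mem_range.1 hd
      rw [show n + 1 - 1 - d = n - d by omega, Nat.cast_sub (by omega)]
      congr 1
      push_cast
      ring
    have hlast' : ∑ a ∈ Finset.Icc 1 (n + 1), f ((a : ℝ) - (n + 1 + 1 : ℕ)) =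
        ∑ d ∈ Finset.range (n + 1), f ((d : ℝ) + 1) := by
      rw [← hlast]
      exact Finset.sum_congr rfl fun a _ => by rw [← hf, neg_sub]
    rw [Finset.sum_Icc_succ_top (by omega)]
    simp only [fun a : ℕ => Finset.sum_Icc_succ_top (show 1 ≤ n + 1 + 1 by omega)
      (fun b : ℕ => f ((a : ℝ) - b))]
    rw [Finset.sum_add_distrib, hlast, hlast', ih, sub_self, h0,
      Finset.sum_range_succ (fun k => ∑ d ∈ Finset.range (k + 1), f ((d : ℝ) + 1)) n]
    ring

theorem lemma4 (m : ℕ) (hm : 2 ≤ m) (φ : Ranking m) (ε : ℝ) (hε : 0 < ε) :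
    ∫ y, concordantPairs φ.toVec y ∂(laplaceMechanism (2 * ((m : ℝ) - 1) * ε⁻¹) φ) <
      ∫ r, concordantPairs φ.toVec (fun i => (r i : ℝ))
        ∂(rankingAlgorithm (Nat.one_le_of_lt hm) ε φ).toMeasure := by
  obtain ⟨n, rfl⟩ : ∃ n, m = n + 2 := ⟨m - 2, by omega⟩
  rw [integral_concordantPairs_rankingAlgorithm]
  have hm1 : (0 : ℝ) < ((n + 2 : ℕ) : ℝ) - 1 := by push_cast; linarith [n.cast_nonneg (α := ℝ)]
  set c : ℝ := ε * (((n + 2 : ℕ) : ℝ) - 1)⁻¹ with hcdef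
  have hc : 0 < c := by positivity
  have hscale : 2 * (((n + 2 : ℕ) : ℝ) - 1) * ε⁻¹ = (c / 2)⁻¹ := by
    rw [hcdef]; field_simp
  rw [hscale, integral_concordantPairs_laplaceMechanism (by positivity)]
  have hreindex : ∑ i, ∑ j, laplaceConcordance (c / 2) (φ.toVec i - φ.toVec j) =
      ∑ a ∈ Finset.Icc 1 (n + 1 + 1), ∑ b ∈ Finset.Icc 1 (n + 1 + 1),
        laplaceConcordance (c / 2) ((a : ℝ) - b) := by
    have h : ∀ g : ℕ → ℝ, ∑ i, g (φ i) = ∑ a ∈ Finset.Icc 1 (n + 1 + 1), g a := fun g => 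
      (Equiv.sum_comp φ fun a => g a).trans (Finset.sum_coe_sort _ g)
    simp only [Ranking.toVec]
    rw [← h]
    refine Finset.sum_congr rfl fun i _ => ?_
    exact h fun b => laplaceConcordance (c / 2) (((φ i : ℕ) : ℝ) - b)
  rw [hreindex, sum_sum_Icc_symm _ (by simp [laplaceConcordance])
    (fun x => by simp [laplaceConcordance])]
  refine mul_lt_mul_of_pos_left ?_ two_pos
  refine Finset.sum_lt_sum_of_nonempty ⟨0, by simp⟩ fun k _ => ?_
  rw [positionMean, truncGeomMean_exp hc _ (by omega)]
  -- Only the termwise bound remains: p(d + 1) is at most its version with a = c/2 replaced by 1 -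
  -- e^{-a} in the linear factor.
  refine lt_of_le_of_lt (Finset.sum_le_sum fun d _ => ?_)
    (sum_lt_truncGeomMean (Real.exp_pos _) (Real.exp_lt_one_iff.2 (by linarith)) k)
  have hd : (0 : ℝ) < (d : ℝ) + 1 := by positivity
  have hs : Real.exp (-(c / 4)) ^ 2 = Real.exp (-(c / 2)) := by
    rw [← Real.exp_nat_mul]; congr 1; push_cast; ring
  rw [laplaceConcordance, if_neg hd.ne', abs_of_pos hd, hs, ← Real.exp_nat_mul]
  have he : Real.exp (((d + 1 : ℕ) : ℝ) * -(c / 2)) = Real.exp (-(c / 2) * ((d : ℝ) + 1)) := by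
    congr 1; push_cast; ring
  rw [he]
  have hb : 1 - Real.exp (-(c / 2)) ≤ c / 2 := by linarith [Real.add_one_le_exp (-(c / 2))]
  gcongr 1 - 1 / 2 * _ * (1 + ?_ / 2)
  nlinarith
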